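/- Let $\mathsf{PRA}^2$ be the two-sorted theory of numbers and unary functions on numbers, with the order $<$ and with a symbol for every primitive recursive functional of type 2 (finitely many number and function arguments). Its axioms are: the successor axioms, the recursive definition of $<$, the defining equations of the primitive recursive functionals, induction for quantifier-free formulas with number and function parameters, and the statement that every unary function obtained by applying a primitive recursive functional to given functions and numbers exists. Its models are pairs $(M,\mathcal X)$ with $M$ a possibly nonstandard number domain and $\mathcal X$ a set of functions $M\to M$; a model is standard if its first-order part is the standard one, $M=\omega$. Let $\Delta^0_1\text{-}\mathrm{CA}$ be the scheme $$\forall x\,(\varphi(x)\leftrightarrow\psi(x))\ \rightarrow\ \exists f\,\forall x\,\bigl((\varphi(x)\to f(x)=1)\wedge(\neg\varphi(x)\to f(x)=0)\bigr),$$ where $\varphi$ is $\Sigma^0_1$ and $\psi$ is $\Pi^0_1$, both possibly with number and function parameters. For $n,k\in\omega$, let $\mathsf{RT}^n_k$ be the statement that for every colouring $c\colon[\mathbb N]^n\to k$ (given by a function on codes of increasing $n$-tuples) there is a $\{0,1\}$-valued function $h$ such that $H=\{x: h(x)=1\}$ is unbounded and $c$ is constant on $[H]^n$. **Theorem.** For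 all $n,k\ge 2$, $\mathsf{RT}^n_k$ and $\Delta^0_1\text{-}\mathrm{CA}$ are incomparable over $\mathsf{PRA}^2$: neither of them implies the other in all models of $\mathsf{PRA}^2$. This holds already for standard models: there is a standard model of $\mathsf{PRA}^2$ in which $\mathsf{RT}^n_k$ holds and $\Delta^0_1\text{-}\mathrm{CA}$ fails, and there is a standard model of $\mathsf{PRA}^2$ in which $\Delta^0_1\text{-}\mathrm{CA}$ holds and $\mathsf{RT}^n_k$ fails. -/

import Mathlib

namespace PRA2

/-! ### Primitive recursive schemes -/

/-- `Scheme k m` is the type of definitions of an `m`-ary function that is primitive recursive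
relative to `k` unary functions. The case `k = 0` gives the primitive recursive functions, i.e. the
function symbols of PRA; in general these are the primitive recursive functionals of type 2 with
`k` function arguments and `m` number arguments. -/
inductive Scheme (k : ℕ) : ℕ → Type
  | zero : Scheme k 0
  | succ : Scheme k 1
  | proj {m : ℕ} (i : Fin m) : Scheme k m
  | oracle (j : Fin k) : Scheme k 1
  | comp {m l : ℕ} (g : Scheme k m) (h : Fin m → Scheme k l) : Scheme k l
  /-- `f (0, x) = g x` and `f (y + 1, x) = h (y, f (y, x), x)`. -/
  | prec {m : ℕ} (g : Scheme k m) (h : Scheme k (m + 2)) : Scheme k (m + 1)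

namespace Scheme

variable {k : ℕ}

/-- The function on the standard natural numbers defined by a scheme, relative to `F`. -/
def eval (F : Fin k → ℕ → ℕ) : {m : ℕ} → Scheme k m → (Fin m → ℕ) → ℕ
  | _, .zero, _ => 0
  | _, .succ, v => v 0 + 1
  | _, .proj i, v => v i
  | _, .oracle j, v => F j (v 0)
  | _, .comp g h, v => g.eval F (fun i => (h i).eval F v)
  | _, .prec g h, v =>
      Nat.rec (g.eval F (Fin.tail v))
        (fun y r => h.eval F (Fin.cons y (Fin.cons r (Fin.tail v)))) (v 0)

/-- Addition, by recursion on the first argument. -/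
def add : Scheme k 2 := .prec (.proj 0) (.comp .succ ![.proj 1])

/-- Multiplication, by recursion on the first argument. -/
def mul : Scheme k 2 := .prec (.comp .zero ![]) (.comp add ![.proj 1, .proj 2])

/-- The pairing function `(x, y) ↦ (x + y) * (x + y) + x`. -/
def pair : Scheme k 2 := .comp add ![.comp mul ![add, add], .proj 0]

end Scheme

/-! ### Terms and formulas

The language has two sorts: numbers and (unary) functions. Terms and formulas carry `b` free
function variables and `a` free number variables; the variable bound by a quantifier is the number
variable `0` of its scope. Formulas with function quantifiers occur in none of the axiom schemes
(quantifier-free induction and comprehension for formulas with function parameters), so number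
quantifiers suffice here. -/

/-- Number terms. The symbols `0` and `s` are the schemes `Scheme.zero`, `Scheme.succ`. -/
inductive Term (b a : ℕ) : Type
  | var (i : Fin a) : Term b a
  | app (f : Fin b) (t : Term b a) : Term b a
  | sym {k m : ℕ} (P : Scheme k m) (f : Fin k → Fin b) (t : Fin m → Term b a) : Term b a

/-- Formulas with function parameters. The bounded quantifiers `(∀ x < t)`, `(∃ x < t)` have their
own constructors; the bound `t` lives in the outer scope, so it does not mention `x`. -/
inductive Formula (b : ℕ) : ℕ → Type
  | eq {a : ℕ} (t u : Term b a) : Formula b a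
  | lt {a : ℕ} (t u : Term b a) : Formula b a
  | neg {a : ℕ} (φ : Formula b a) : Formula b a
  | and {a : ℕ} (φ ψ : Formula b a) : Formula b a
  | or {a : ℕ} (φ ψ : Formula b a) : Formula b a
  | imp {a : ℕ} (φ ψ : Formula b a) : Formula b a
  | ball {a : ℕ} (t : Term b a) (φ : Formula b (a + 1)) : Formula b a
  | bex {a : ℕ} (t : Term b a) (φ : Formula b (a + 1)) : Formula b a
  | all {a : ℕ} (φ : Formula b (a + 1)) : Formula b a
  | ex {a : ℕ} (φ : Formula b (a + 1)) : Formula b a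

namespace Formula

variable {b : ℕ}

/-- Quantifier-free formulas. -/
inductive IsQF : {a : ℕ} → Formula b a → Prop
  | eq {a : ℕ} (t u : Term b a) : IsQF (.eq t u)
  | lt {a : ℕ} (t u : Term b a) : IsQF (.lt t u)
  | neg {a : ℕ} {φ : Formula b a} : IsQF φ → IsQF (.neg φ)
  | and {a : ℕ} {φ ψ : Formula b a} : IsQF φ → IsQF ψ → IsQF (.and φ ψ)
  | or {a : ℕ} {φ ψ : Formula b a} : IsQF φ → IsQF ψ → IsQF (.or φ ψ)
  | imp {a : ℕ} {φ ψ : Formula b a} : IsQF φ → IsQF ψ → IsQF (.imp φ ψ)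

/-- `Δ⁰₀` formulas: all quantifiers are bounded. -/
inductive IsDelta0 : {a : ℕ} → Formula b a → Prop
  | eq {a : ℕ} (t u : Term b a) : IsDelta0 (.eq t u)
  | lt {a : ℕ} (t u : Term b a) : IsDelta0 (.lt t u)
  | neg {a : ℕ} {φ : Formula b a} : IsDelta0 φ → IsDelta0 (.neg φ)
  | and {a : ℕ} {φ ψ : Formula b a} : IsDelta0 φ → IsDelta0 ψ → IsDelta0 (.and φ ψ)
  | or {a : ℕ} {φ ψ : Formula b a} : IsDelta0 φ → IsDelta0 ψ → IsDelta0 (.or φ ψ)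
  | imp {a : ℕ} {φ ψ : Formula b a} : IsDelta0 φ → IsDelta0 ψ → IsDelta0 (.imp φ ψ)
  | ball {a : ℕ} (t : Term b a) {φ : Formula b (a + 1)} : IsDelta0 φ → IsDelta0 (.ball t φ)
  | bex {a : ℕ} (t : Term b a) {φ : Formula b (a + 1)} : IsDelta0 φ → IsDelta0 (.bex t φ)

/-- `Σ⁰₁` formulas: a block of existential quantifiers before a `Δ⁰₀` formula. -/
inductive IsSigma1 : {a : ℕ} → Formula b a → Prop
  | delta0 {a : ℕ} {φ : Formula b a} : IsDelta0 φ → IsSigma1 φ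
  | ex {a : ℕ} {φ : Formula b (a + 1)} : IsSigma1 φ → IsSigma1 (.ex φ)

/-- `Π⁰₁` formulas: a block of universal quantifiers before a `Δ⁰₀` formula. -/
inductive IsPi1 : {a : ℕ} → Formula b a → Prop
  | delta0 {a : ℕ} {φ : Formula b a} : IsDelta0 φ → IsPi1 φ
  | all {a : ℕ} {φ : Formula b (a + 1)} : IsPi1 φ → IsPi1 (.all φ)

end Formula

/-! ### Structures -/

/-- A structure for the two-sorted language: a possibly nonstandard number domain `M`, and a
function domain `fn` consisting of functions on `M`. -/
structure Struc : Type 1 where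
  M : Type
  fn : Set (M → M)
  lt : M → M → Prop
  interp : {k m : ℕ} → Scheme k m → (Fin k → fn) → (Fin m → M) → M

namespace Struc

variable (S : Struc)

def zero : S.M := S.interp (k := 0) .zero ![] ![]

def succ (x : S.M) : S.M := S.interp (k := 0) .succ ![] ![x]

def pair (x y : S.M) : S.M := S.interp (k := 0) .pair ![] ![x, y]

/-- The value of the numeral of a standard number. -/
def num : ℕ → S.M
  | 0 => S.zero
  | n + 1 => S.succ (num n)

/-- The code of an `n`-tuple of numbers, for standard `n`, by iterated pairing. -/
def tuple : (n : ℕ) → (Fin n → S.M) → S.M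
  | 0, _ => S.zero
  | n + 1, x => S.pair (x 0) (tuple n (Fin.tail x))

/-- The value of a term. -/
def val {b a : ℕ} (F : Fin b → S.fn) (p : Fin a → S.M) : Term b a → S.M
  | .var i => p i
  | .app f t => (F f).1 (val F p t)
  | .sym P f t => S.interp P (fun j => F (f j)) (fun i => val F p (t i))

/-- Satisfaction of a formula. -/
def Sat {b : ℕ} (F : Fin b → S.fn) : {a : ℕ} → (Fin a → S.M) → Formula b a → Prop
  | _, p, .eq t u => S.val F p t = S.val F p u
  | _, p, .lt t u => S.lt (S.val F p t) (S.val F p u)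
  | _, p, .neg φ => ¬ Sat F p φ
  | _, p, .and φ ψ => Sat F p φ ∧ Sat F p ψ
  | _, p, .or φ ψ => Sat F p φ ∨ Sat F p ψ
  | _, p, .imp φ ψ => Sat F p φ → Sat F p ψ
  | _, p, .ball t φ => ∀ x, S.lt x (S.val F p t) → Sat F (Fin.cons x p) φ
  | _, p, .bex t φ => ∃ x, S.lt x (S.val F p t) ∧ Sat F (Fin.cons x p) φ
  | _, p, .all φ => ∀ x, Sat F (Fin.cons x p) φ
  | _, p, .ex φ => ∃ x, Sat F (Fin.cons x p) φ

/-- `S` is a model of PRA². -/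
structure IsModel : Prop where
  zero_ne_succ : ∀ x, S.zero ≠ S.succ x
  succ_inj : ∀ x y, S.succ x = S.succ y → x = y
  -- the recursive definition of the order
  not_lt_zero : ∀ x, ¬ S.lt x S.zero
  lt_succ : ∀ x y, S.lt x (S.succ y) ↔ S.lt x y ∨ x = y
  -- the defining equations of the primitive recursive functionals
  zero_eq : ∀ {k : ℕ} (F : Fin k → S.fn) (v : Fin 0 → S.M), S.interp .zero F v = S.zero
  succ_eq : ∀ {k : ℕ} (F : Fin k → S.fn) (v : Fin 1 → S.M), S.interp .succ F v = S.succ (v 0)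
  proj_eq : ∀ {k m : ℕ} (F : Fin k → S.fn) (i : Fin m) (v : Fin m → S.M),
    S.interp (.proj i) F v = v i
  oracle_eq : ∀ {k : ℕ} (F : Fin k → S.fn) (j : Fin k) (v : Fin 1 → S.M),
    S.interp (.oracle j) F v = (F j).1 (v 0)
  comp_eq : ∀ {k m l : ℕ} (F : Fin k → S.fn) (g : Scheme k m) (h : Fin m → Scheme k l)
    (v : Fin l → S.M), S.interp (.comp g h) F v = S.interp g F (fun i => S.interp (h i) F v)
  prec_zero : ∀ {k m : ℕ} (F : Fin k → S.fn) (g : Scheme k m) (h : Scheme k (m + 2))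
    (v : Fin m → S.M), S.interp (.prec g h) F (Fin.cons S.zero v) = S.interp g F v
  prec_succ : ∀ {k m : ℕ} (F : Fin k → S.fn) (g : Scheme k m) (h : Scheme k (m + 2))
    (y : S.M) (v : Fin m → S.M), S.interp (.prec g h) F (Fin.cons (S.succ y) v) =
      S.interp h F (Fin.cons y (Fin.cons (S.interp (.prec g h) F (Fin.cons y v)) v))
  -- quantifier-free induction, with number and function parameters
  qf_induction : ∀ {b a : ℕ} (θ : Formula b (a + 1)), θ.IsQF →
    ∀ (F : Fin b → S.fn) (p : Fin a → S.M),
      S.Sat F (Fin.cons S.zero p) θ →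
      (∀ x, S.Sat F (Fin.cons x p) θ → S.Sat F (Fin.cons (S.succ x) p) θ) →
      ∀ x, S.Sat F (Fin.cons x p) θ
  -- the values of the primitive recursive functionals belong to the function domain
  closed : ∀ {k m : ℕ} (P : Scheme k (m + 1)) (F : Fin k → S.fn) (p : Fin m → S.M),
    ∃ g ∈ S.fn, ∀ x, g x = S.interp P F (Fin.cons x p)

/-- The standard structure `(ω, X)`: the numbers are the standard natural numbers, all symbols have
their standard meaning, and the function variables range over `X`. -/
def omega (X : Set (ℕ → ℕ)) : Struc where
  M := ℕ
  fn := X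
  lt := fun x y => x < y
  interp := fun P F v => P.eval (fun j => (F j).1) v

/-- `S` is standard, i.e. its first-order part is the standard one. -/
def IsStandard : Prop := ∃ X : Set (ℕ → ℕ), S = omega X

/-! ### The two principles -/

/-- `Δ⁰₁`-comprehension, `Δ⁰₁-CA`: if a `Σ⁰₁` formula `φ` and a `Π⁰₁` formula `ψ`, with parameters,
are equivalent, then `φ` has a characteristic function. -/
def Delta01CA : Prop :=
  ∀ {b a : ℕ} (φ ψ : Formula b (a + 1)), φ.IsSigma1 → ψ.IsPi1 →
    ∀ (F : Fin b → S.fn) (p : Fin a → S.M),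
      (∀ x, S.Sat F (Fin.cons x p) φ ↔ S.Sat F (Fin.cons x p) ψ) →
      ∃ f ∈ S.fn, ∀ x,
        (S.Sat F (Fin.cons x p) φ → f x = S.num 1) ∧ (¬ S.Sat F (Fin.cons x p) φ → f x = S.num 0)

/-- `x₀ < x₁ < ⋯`, so that `x` represents an `n`-element set of numbers. -/
def Increasing {n : ℕ} (x : Fin n → S.M) : Prop := ∀ i j, i < j → S.lt (x i) (x j)

/-- The function `c` is a colouring of the `n`-element sets of numbers with `k` colours. -/
def IsColouring (n k : ℕ) (c : S.M → S.M) : Prop :=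
  ∀ x : Fin n → S.M, S.Increasing x → S.lt (c (S.tuple n x)) (S.num k)

/-- `h` is the characteristic function of an unbounded set. -/
def IsInfiniteSet (h : S.M → S.M) : Prop :=
  (∀ x, h x = S.num 0 ∨ h x = S.num 1) ∧ ∀ m, ∃ x, S.lt m x ∧ h x = S.num 1

/-- The set with characteristic function `h` is homogeneous for the colouring `c`. -/
def IsHomogeneous (n : ℕ) (c h : S.M → S.M) : Prop :=
  ∃ i, ∀ x : Fin n → S.M, S.Increasing x → (∀ j, h (x j) = S.num 1) → c (S.tuple n x) = i

/-- Ramsey's theorem `RT^n_k`, with solutions coded as characteristic functions. -/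
def RT (n k : ℕ) : Prop :=
  ∀ c ∈ S.fn, S.IsColouring n k c → ∃ h ∈ S.fn, S.IsInfiniteSet h ∧ S.IsHomogeneous n c h

end Struc

/-- Over PRA², the principle `A` implies the principle `B`. -/
def Implies (A B : Struc → Prop) : Prop := ∀ S : Struc, S.IsModel → A S → B S

/-- The principle `A` implies the principle `B` in all standard models of PRA². -/
def ImpliesStandard (A B : Struc → Prop) : Prop :=
  ∀ S : Struc, S.IsStandard → S.IsModel → A S → B S

/-- Over PRA², neither of two principles implies the other. -/
def Incomparable (A B : Struc → Prop) : Prop := ¬ Implies A B ∧ ¬ Implies B A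

/-- In standard models of PRA², neither of two principles implies the other. -/
def IncomparableStandard (A B : Struc → Prop) : Prop :=
  ¬ ImpliesStandard A B ∧ ¬ ImpliesStandard B A

end PRA2

namespace PRA2

/-! ### The infinite Ramsey theorem -/

/-! Both separations are witnessed by standard models.

For RT without comprehension, the point is that a type-2 primitive recursive functional halts on
every oracle, reading only finitely much of it. A finite piece of an oracle, padded with zeros,
already lies in the class `X` built so far, so a functional applied to it cannot produce a function
`A` outside `X`, and some finite piece of the oracle witnesses the disagreement. By Baire category,
any `w` can therefore be thinned to a restriction that meets countably many prescribed infinite sets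
and still does not make `A` primitive recursive (`exists_restrict_avoiding`). This is used twice.
First, a function listing the graph of a diagonal set `A` is thinned, so that `A` becomes `Δ⁰₁` in a
member of the class without belonging to it (`exists_omits`). Then, for each colouring, a
homogeneous set given by the infinite Ramsey theorem is thinned; unbounded subsets of homogeneous
sets are again solutions. Solutions are characteristic functions, so thinning costs nothing.
Iterating `ω` times closes the class under RT and keeps `A` out (`Omits.exists_RT`).

For comprehension without RT, the computable functions form the model: `Δ⁰₁` sets are decided by
unbounded search, and a finite-injury-free diagonalisation gives a computable colouring of pairs
with no computable homogeneous set (`compStruc_not_RT`). -/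

theorem ramsey_step {n : ℕ} {α : Type} (c : (Fin (n + 1) → ℕ) → α)
    (ih : ∀ (c : (Fin n → ℕ) → α) (A : Set ℕ), A.Infinite → ∃ H ⊆ A, H.Infinite ∧
      ∃ i, ∀ x : Fin n → ℕ, StrictMono x → (∀ j, x j ∈ H) → c x = i)
    (A : Set ℕ) (hA : A.Infinite) :
    ∃ a ∈ A, ∃ B ⊆ A, B.Infinite ∧ (∀ b ∈ B, a < b) ∧
      ∃ i, ∀ x : Fin n → ℕ, StrictMono x → (∀ j, x j ∈ B) → c (Fin.cons a x) = i := by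
  obtain ⟨a, ha⟩ := hA.nonempty
  have hinf : (A ∩ Set.Ioi a).Infinite := by
    refine Set.infinite_of_not_bddAbove fun ⟨m, hm⟩ => ?_
    obtain ⟨b, hb, hlt⟩ := hA.exists_gt (max a m)
    exact absurd (hm ⟨hb, lt_of_le_of_lt (le_max_left _ _) hlt⟩)
      (not_le.2 (lt_of_le_of_lt (le_max_right _ _) hlt))
  obtain ⟨B, hB, hBinf, i, hi⟩ := ih (fun x => c (Fin.cons a x)) _ hinf
  exact ⟨a, ha, B, fun b hb => (hB hb).1, hBinf, fun b hb => (hB hb).2, i, hi⟩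

/-- Iterating `ramsey_step` yields a sequence along which the colour of a tuple depends only on its
first element; the pigeonhole principle then fixes that colour on an infinite subsequence. -/
theorem ramsey {α : Type} [Finite α] (n : ℕ) : ∀ (c : (Fin n → ℕ) → α) (A : Set ℕ), A.Infinite →
    ∃ H ⊆ A, H.Infinite ∧
      ∃ i, ∀ x : Fin n → ℕ, StrictMono x → (∀ j, x j ∈ H) → c x = i := by
  induction n with
  | zero => exact fun c A hA => ⟨A, subset_rfl, hA, c ![], fun x _ _ => by
      rw [Subsingleton.elim x ![]]⟩
  | succ n ih =>
    intro c A hA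
    choose a haA B hBA hBinf haB col hcol using ramsey_step c ih
    let S : ℕ → {A : Set ℕ // A.Infinite} := fun j =>
      Nat.rec ⟨A, hA⟩ (fun _ s => ⟨B s.1 s.2, hBinf s.1 s.2⟩) j
    let e : ℕ → ℕ := fun j => a (S j).1 (S j).2
    have hanti : Antitone fun j => (S j).1 := antitone_nat_of_succ_le fun j => hBA _ _
    have hmem : ∀ j l, j < l → e l ∈ B (S j).1 (S j).2 := fun j l h =>
      hanti (Nat.succ_le_of_lt h) (haA _ _)
    have he : StrictMono e := fun j l h => haB _ _ _ (hmem j l h)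
    obtain ⟨i, hi⟩ := Finite.exists_infinite_fiber fun j => col (S j).1 (S j).2
    refine ⟨e '' ((fun j => col (S j).1 (S j).2) ⁻¹' {i}), ?_, ?_, i, ?_⟩
    · rintro _ ⟨j, -, rfl⟩
      exact hanti (Nat.zero_le j) (haA _ _)
    · exact (Set.infinite_coe_iff.1 hi).image he.injective.injOn
    · intro x hx hxH
      obtain ⟨j, hj, hjx⟩ := hxH 0
      have hx0 : x = Fin.cons (e j) (Fin.tail x) := by
        rw [hjx]; exact (Fin.cons_self_tail x).symm
      rw [hx0]
      rw [← (show col (S j).1 (S j).2 = i from hj)]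
      refine hcol (S j).1 (S j).2 _ (fun p q h => hx (Fin.succ_lt_succ_iff.2 h)) fun p => ?_
      obtain ⟨l, -, hl⟩ := hxH p.succ
      change x p.succ ∈ _
      rw [← hl]
      refine hmem j l (he.lt_iff_lt.1 ?_)
      rw [hjx, hl]
      exact hx (Fin.succ_pos p)

/-! ### Programs with an arbitrary family of oracles -/

/-- Definitions of functions that are primitive recursive relative to unary functions indexed by
`ι`. -/
inductive Prog (ι : Type) : ℕ → Type
  | zero : Prog ι 0
  | succ : Prog ι 1
  | proj {m : ℕ} (i : Fin m) : Prog ι m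
  | oracle (j : ι) : Prog ι 1
  | comp {m l : ℕ} (g : Prog ι m) (h : Fin m → Prog ι l) : Prog ι l
  | prec {m : ℕ} (g : Prog ι m) (h : Prog ι (m + 2)) : Prog ι (m + 1)

namespace Prog

variable {ι κ : Type}

/-- The function defined by a program, relative to `F`. -/
def eval (F : ι → ℕ → ℕ) : {m : ℕ} → Prog ι m → (Fin m → ℕ) → ℕ
  | _, .zero, _ => 0
  | _, .succ, v => v 0 + 1
  | _, .proj i, v => v i
  | _, .oracle j, v => F j (v 0)
  | _, .comp g h, v => g.eval F (fun i => (h i).eval F v)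
  | _, .prec g h, v =>
      Nat.rec (g.eval F (Fin.tail v))
        (fun y r => h.eval F (Fin.cons y (Fin.cons r (Fin.tail v)))) (v 0)

/-- Substitution of programs for the oracles. -/
def bind (σ : ι → Prog κ 1) : {m : ℕ} → Prog ι m → Prog κ m
  | _, .zero => .zero
  | _, .succ => .succ
  | _, .proj i => .proj i
  | _, .oracle j => σ j
  | _, .comp g h => .comp (g.bind σ) fun i => (h i).bind σ
  | _, .prec g h => .prec (g.bind σ) (h.bind σ)

theorem eval_bind (σ : ι → Prog κ 1) (F : κ → ℕ → ℕ) {m : ℕ} (P : Prog ι m) (v : Fin m → ℕ) :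
    (P.bind σ).eval F v = P.eval (fun j x => (σ j).eval F fun _ => x) v := by
  induction P with
  | zero | succ | proj i => rfl
  | oracle j =>
    simp only [bind, eval]
    congr 1
    funext i
    rw [Subsingleton.elim i 0]
  | comp g h ihg ihh => simp only [bind, eval, ihg, ihh]
  | prec g h ihg ihh => simp only [bind, eval, ihg, ihh]

/-- A type-2 functional as a program. -/
def ofScheme {k : ℕ} (σ : Fin k → ι) : {m : ℕ} → Scheme k m → Prog ι m
  | _, .zero => .zero
  | _, .succ => .succ
  | _, .proj i => .proj i
  | _, .oracle j => .oracle (σ j)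
  | _, .comp g h => .comp (ofScheme σ g) fun i => ofScheme σ (h i)
  | _, .prec g h => .prec (ofScheme σ g) (ofScheme σ h)

theorem eval_ofScheme {k : ℕ} (σ : Fin k → ι) (F : ι → ℕ → ℕ) {m : ℕ} (P : Scheme k m)
    (v : Fin m → ℕ) : (ofScheme σ P).eval F v = P.eval (fun j => F (σ j)) v := by
  induction P with
  | zero | succ | proj i | oracle j => rfl
  | comp g h ihg ihh => simp only [ofScheme, eval, Scheme.eval, ihg, ihh]
  | prec g h ihg ihh => simp only [ofScheme, eval, Scheme.eval, ihg, ihh]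

/-- The program of a constant function. -/
def const {m : ℕ} : ℕ → Prog ι m
  | 0 => .comp .zero ![]
  | n + 1 => .comp .succ fun _ => const n

@[simp]
theorem eval_const (F : ι → ℕ → ℕ) {m : ℕ} (n : ℕ) (v : Fin m → ℕ) :
    (const n : Prog ι m).eval F v = n := by
  induction n with
  | zero => rfl
  | succ n ih => simp [const, eval, ih]

theorem exists_eval_eq_of_eventually_zero (F : ι → ℕ → ℕ) (N : ℕ) :
    ∀ g : ℕ → ℕ, (∀ x, N ≤ x → g x = 0) →
      ∃ P : Prog ι 1, ∀ v : Fin 1 → ℕ, P.eval F v = g (v 0) := by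
  induction N with
  | zero => exact fun g hg => ⟨const 0, fun v => by simp [hg]⟩
  | succ N ih =>
    intro g hg
    obtain ⟨P, hP⟩ := ih (fun x => g (x + 1)) fun x hx => hg _ (by omega)
    -- The recursion serves as a case distinction: the step ignores the previous value and applies
    -- `P` to the predecessor.
    refine ⟨.prec (const (g 0)) (.comp P ![.proj 0]), fun v => ?_⟩
    simp only [eval, eval_const, hP]
    cases v 0 <;> simp [eval]

/-- A numerical code of a program. -/
def enc (e : ι → ℕ) : {m : ℕ} → Prog ι m → ℕ
  | _, .zero => Nat.pair 0 0
  | _, .succ => Nat.pair 1 0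
  | _, .proj i => Nat.pair 2 i
  | _, .oracle j => Nat.pair 3 (e j)
  -- The intermediate arity is recorded, so that equal codes force equal types before the components
  -- are compared.
  | _, @Prog.comp _ m _ g h => Nat.pair 4
      (Nat.pair m (Nat.pair (g.enc e) (Encodable.encode fun i => (h i).enc e)))
  | _, .prec g h => Nat.pair 5 (Nat.pair (g.enc e) (h.enc e))

theorem enc_injective {e : ι → ℕ} (he : Function.Injective e) {m : ℕ} (P : Prog ι m) :
    ∀ Q : Prog ι m, P.enc e = Q.enc e → P = Q := by
  induction P with
  | zero | succ => intro Q h; cases Q <;> simp_all [enc]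
  | proj i => intro Q h; cases Q <;> simp_all [enc, Fin.ext_iff]
  | oracle j =>
    intro Q h
    cases Q <;> simp_all [enc]
    exact he h
  | @comp m l g s ihg ihs =>
    intro Q h
    cases Q with
    | @comp m' _ g' s' =>
      simp only [enc, Nat.pair_eq_pair, true_and] at h
      obtain ⟨rfl, hg, hs⟩ := h
      rw [ihg _ hg]
      congr 1
      funext i
      exact ihs i _ (congrFun (Encodable.encode_injective hs) i)
    | _ => simp [enc] at h
  | prec g s ihg ihs =>
    intro Q h
    cases Q with
    | prec g' s' =>
      simp only [enc, Nat.pair_eq_pair, true_and] at h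
      rw [ihg _ h.1, ihs _ h.2]
    | _ => simp [enc] at h

instance [Countable ι] (m : ℕ) : Countable (Prog ι m) := by
  obtain ⟨e, he⟩ := Countable.exists_injective_nat ι
  exact Function.Injective.countable (f := enc e) fun P Q h => enc_injective he P Q h

/-! ### Continuity of programs in their oracles -/

theorem continuous_apply_nat {α β : Type} [TopologicalSpace α] [TopologicalSpace β]
    {f : α → ℕ → β} {n : α → ℕ} (hf : ∀ i, Continuous fun a => f a i) (hn : Continuous n) :
    Continuous fun a => f a (n a) := by
  refine continuous_iff_continuousAt.2 fun a => ?_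
  have h : ∀ᶠ b in nhds a, n b = n a := 
    hn.continuousAt (show {n a} ∈ nhds (n a) from mem_nhds_discrete.2 rfl)
  refine ((hf (n a)).continuousAt).congr ?_
  filter_upwards [h] with b hb
  rw [hb]

/-- A terminating computation consults finitely many oracle values. In the recursion case the number
of rounds is locally constant, so it suffices to treat each fixed number of rounds. -/
theorem continuous_eval {α : Type} [TopologicalSpace α] {F : α → ι → ℕ → ℕ}
    (hF : ∀ j x, Continuous fun a => F a j x) {m : ℕ} (P : Prog ι m) :
    ∀ v : α → Fin m → ℕ, (∀ i, Continuous fun a => v a i) →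
      Continuous fun a => P.eval (F a) (v a) := by
  induction P with
  | zero => exact fun v _ => continuous_const
  | succ => exact fun v hv => continuous_of_discreteTopology.comp (hv 0)
  | proj i => exact fun v hv => hv i
  | oracle j => exact fun v hv => continuous_apply_nat (hF j) (hv 0)
  | comp g h ihg ihh => exact fun v hv => ihg _ fun i => ihh i v hv
  | prec g h ihg ihh =>
    intro v hv
    refine continuous_apply_nat (f := fun a y => @Nat.rec (fun _ => ℕ) (g.eval (F a) (Fin.tail (v a)))
        (fun y r => h.eval (F a) (Fin.cons y (Fin.cons r (Fin.tail (v a))))) y) (fun y => ?_) (hv 0)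
    induction y with
    | zero => exact ihg _ fun i => hv i.succ
    | succ y ih =>
      refine ihh _ fun i => ?_
      refine Fin.cases ?_ (fun i => ?_) i
      · exact continuous_const
      · refine Fin.cases ?_ (fun i => ?_) i
        · exact ih
        · exact hv i.succ

end Prog
end PRA2

namespace PRA2

open Set

/-! ### Standard structures -/

theorem Scheme.eval_add {k : ℕ} (F : Fin k → ℕ → ℕ) (v : Fin 2 → ℕ) :
    Scheme.add.eval F v = v 0 + v 1 := by
  simp only [Scheme.add, Scheme.eval]
  induction v 0 with
  | zero => simp [Fin.tail]
  | succ n ih =>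
    simp only [ih]
    exact (show n + v 1 + 1 = n + 1 + v 1 by omega)

theorem Scheme.eval_mul {k : ℕ} (F : Fin k → ℕ → ℕ) (v : Fin 2 → ℕ) :
    Scheme.mul.eval F v = v 0 * v 1 := by
  simp only [Scheme.mul, Scheme.eval]
  induction v 0 with
  | zero => simp
  | succ n ih =>
    simp only [ih]
    simp only [Scheme.eval_add]
    exact (show n * v 1 + v 1 = (n + 1) * v 1 by ring)

theorem Scheme.eval_pair {k : ℕ} (F : Fin k → ℕ → ℕ) (v : Fin 2 → ℕ) :
    Scheme.pair.eval F v = (v 0 + v 1) * (v 0 + v 1) + v 0 := by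
  simp [Scheme.pair, Scheme.eval, Scheme.eval_add, Scheme.eval_mul]

/-- The code of a tuple of standard numbers. -/
def tupleCode : (n : ℕ) → (Fin n → ℕ) → ℕ
  | 0, _ => 0
  | n + 1, x => (x 0 + tupleCode n (Fin.tail x)) * (x 0 + tupleCode n (Fin.tail x)) + x 0

namespace Struc

variable (X : Set (ℕ → ℕ))

theorem omega_pair (x y : ℕ) : (omega X).pair x y = (x + y) * (x + y) + x :=
  Scheme.eval_pair _ _

theorem omega_tuple (n : ℕ) (x : Fin n → ℕ) : (omega X).tuple n x = tupleCode n x := by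
  induction n with
  | zero => rfl
  | succ n ih =>
    exact (omega_pair X (x 0) _).trans
      (congrArg (fun y => (x 0 + y) * (x 0 + y) + x 0) (ih (Fin.tail x)))

theorem omega_num (n : ℕ) : (omega X).num n = n := by
  induction n with
  | zero => rfl
  | succ n ih => exact congrArg Nat.succ ih

theorem omega_increasing {n : ℕ} (x : Fin n → ℕ) : (omega X).Increasing x ↔ StrictMono x :=
  ⟨fun h _ _ => h _ _, fun h i j => @h i j⟩

theorem omega_isColouring (n k : ℕ) (c : ℕ → ℕ) :
    (omega X).IsColouring n k c ↔ ∀ x : Fin n → ℕ, StrictMono x → c (tupleCode n x) < k := by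
  refine forall_congr' fun x => ?_
  rw [omega_increasing X x, omega_tuple X n x, omega_num X k]
  rfl

theorem omega_isInfiniteSet (h : ℕ → ℕ) :
    (omega X).IsInfiniteSet h ↔ (∀ x, h x = 0 ∨ h x = 1) ∧ ∀ m, ∃ x, m < x ∧ h x = 1 := by
  unfold IsInfiniteSet
  rw [omega_num X 0, omega_num X 1]
  rfl

theorem omega_isHomogeneous (n : ℕ) (c h : ℕ → ℕ) :
    (omega X).IsHomogeneous n c h ↔
      ∃ i, ∀ x : Fin n → ℕ, StrictMono x → (∀ j, h (x j) = 1) → c (tupleCode n x) = i := by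
  refine exists_congr fun i => forall_congr' fun x => ?_
  rw [omega_increasing X x, omega_tuple X n x, omega_num X 1]
  rfl

theorem omega_isModel
    (hX : ∀ {k m : ℕ} (P : Scheme k (m + 1)) (F : Fin k → X) (p : Fin m → ℕ),
      (fun x => P.eval (fun j => (F j).1) (Fin.cons x p)) ∈ X) : (omega X).IsModel where
  zero_ne_succ x h := Nat.succ_ne_zero x h.symm
  succ_inj x y h := Nat.succ_injective h
  not_lt_zero x := Nat.not_lt_zero x
  lt_succ x y := Nat.lt_succ_iff_lt_or_eq
  zero_eq _ _ := rfl
  succ_eq _ _ := rfl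
  proj_eq _ _ _ := rfl
  oracle_eq _ _ _ := rfl
  comp_eq _ _ _ _ := rfl
  prec_zero _ _ _ _ := rfl
  prec_succ _ _ _ _ _ := rfl
  qf_induction θ _ F p h0 hs x := by
    induction x with
    | zero => exact h0
    | succ x ih => exact hs x ih
  closed P F p := ⟨_, hX P F p, fun _ => rfl⟩

end Struc

/-! ### Classes closed under primitive recursion -/

/-- `X` contains every unary function that is primitive recursive relative to members of `X`. -/
def Closed (X : Set (ℕ → ℕ)) : Prop :=
  ∀ P : Prog X 1, (fun x => P.eval (fun f => f.1) fun _ => x) ∈ X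

/-- The unary functions that are primitive recursive relative to `F`. -/
def closure {ι : Type} (F : ι → ℕ → ℕ) : Set (ℕ → ℕ) :=
  range fun (P : Prog ι 1) x => P.eval F fun _ => x

theorem mem_closure {ι : Type} (F : ι → ℕ → ℕ) (i : ι) : F i ∈ closure F :=
  ⟨.oracle i, rfl⟩

theorem closed_closure {ι : Type} (F : ι → ℕ → ℕ) : Closed (closure F) := by
  intro P
  choose σ hσ using fun f : closure F => f.2
  refine ⟨P.bind σ, ?_⟩
  funext x
  change (P.bind σ).eval F _ = _
  rw [Prog.eval_bind]
  congr 1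
  funext f
  exact hσ f

theorem countable_closure {ι : Type} [Countable ι] (F : ι → ℕ → ℕ) : (closure F).Countable :=
  countable_range _

theorem Closed.eval_mem {X : Set (ℕ → ℕ)} (hX : Closed X) {ι : Type} {F : ι → ℕ → ℕ}
    (hF : ∀ i, F i ∈ X) (P : Prog ι 1) : (fun x => P.eval F fun _ => x) ∈ X := by
  have h := hX (P.bind fun i => .oracle ⟨F i, hF i⟩)
  simp only [Prog.eval_bind] at h
  exact h

theorem Closed.mem_of_eventually_zero {X : Set (ℕ → ℕ)} (hX : Closed X) {g : ℕ → ℕ} {N : ℕ}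
    (hg : ∀ x, N ≤ x → g x = 0) : g ∈ X := by
  obtain ⟨P, hP⟩ := Prog.exists_eval_eq_of_eventually_zero (fun f : X => f.1) N g hg
  have h := hX P
  simpa only [hP] using h

/-- Number parameters turn into constant programs, so closure under unary programs is enough. -/
theorem Closed.isModel {X : Set (ℕ → ℕ)} (hX : Closed X) : (Struc.omega X).IsModel := by
  refine Struc.omega_isModel X fun {k m} P F p => ?_
  have h := hX (.comp (.ofScheme F P) (Fin.cons (.proj 0) fun i => .const (p i)))
  convert h using 2 with x
  simp only [Prog.eval, Prog.eval_ofScheme]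
  congr 1
  funext i
  refine Fin.cases ?_ (fun i => ?_) i
  · rfl
  · simp

/-- A program mentions finitely many oracles, and these all occur by some stage of the chain. -/
theorem Prog.exists_eval_eq_of_iUnion {X : ℕ → Set (ℕ → ℕ)} (hX : Monotone X) {m : ℕ}
    (P : Prog (⋃ i, X i : Set (ℕ → ℕ)) m) :
    ∃ i, ∀ j, i ≤ j → ∃ Q : Prog (X j) m, Q.eval (fun f => f.1) = P.eval fun f => f.1 := by
  induction P with
  | zero => exact ⟨0, fun j _ => ⟨.zero, rfl⟩⟩
  | succ => exact ⟨0, fun j _ => ⟨.succ, rfl⟩⟩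
  | proj i => exact ⟨0, fun j _ => ⟨.proj i, rfl⟩⟩
  | oracle f =>
    obtain ⟨i, hi⟩ := mem_iUnion.1 f.2
    exact ⟨i, fun j hj => ⟨.oracle ⟨f.1, hX hj hi⟩, rfl⟩⟩
  | comp g h ihg ihh =>
    obtain ⟨i, hi⟩ := ihg
    choose a ha using ihh
    refine ⟨max i (Finset.univ.sup a), fun j hj => ?_⟩
    obtain ⟨g', hg⟩ := hi j ((le_max_left _ _).trans hj)
    choose h' hh using fun l =>
      ha l j ((Finset.le_sup (Finset.mem_univ l)).trans ((le_max_right _ _).trans hj))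
    refine ⟨.comp g' h', ?_⟩
    funext v
    simp only [Prog.eval, hg, hh]
  | prec g h ihg ihh =>
    obtain ⟨i, hi⟩ := ihg
    obtain ⟨i', hi'⟩ := ihh
    refine ⟨max i i', fun j hj => ?_⟩
    obtain ⟨g', hg⟩ := hi j ((le_max_left _ _).trans hj)
    obtain ⟨h', hh⟩ := hi' j ((le_max_right _ _).trans hj)
    refine ⟨.prec g' h', ?_⟩
    funext v
    simp only [Prog.eval, hg, hh]

theorem Closed.iUnion {X : ℕ → Set (ℕ → ℕ)} (hX : Monotone X) (h : ∀ i, Closed (X i)) :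
    Closed (⋃ i, X i) := by
  intro P
  obtain ⟨i, hi⟩ := P.exists_eval_eq_of_iUnion hX
  obtain ⟨Q, hQ⟩ := hi i le_rfl
  rw [← hQ]
  exact mem_iUnion.2 ⟨i, h i Q⟩

/-! ### Adding a function while avoiding another one -/

/-- The function that agrees with `w` on the set `t` and vanishes elsewhere. -/
def restrict (w : ℕ → ℕ) (t : ℕ → Bool) (x : ℕ) : ℕ := if t x then w x else 0

/-- The oracles `X` together with `g`. -/
def adjoin (X : Set (ℕ → ℕ)) (g : ℕ → ℕ) : Option X → ℕ → ℕ
  | none => g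
  | some f => f.1

/-- Basic open sets of Cantor space are finite conditions. Padding with `false` is what later makes
`restrict w t` vanish eventually, hence belong to every closed class. -/
theorem exists_agree_finite (U : Set (ℕ → Bool)) (hU : IsOpen U) (hne : U.Nonempty) :
    ∃ (t : ℕ → Bool) (N : ℕ), (∀ x, N ≤ x → t x = false) ∧
      ∀ t' : ℕ → Bool, (∀ x < N, t' x = t x) → t' ∈ U := by
  obtain ⟨t, ht⟩ := hne
  obtain ⟨I, u, hu, hIu⟩ := isOpen_pi_iff.1 hU t ht
  refine ⟨fun x => if x < I.sup id + 1 then t x else false, I.sup id + 1, fun x hx => ?_,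
    fun t' ht' => hIu fun x hx => ?_⟩
  · simp [Nat.not_lt.2 hx]
  · have hlt : x < I.sup id + 1 := Nat.lt_succ_of_le (Finset.le_sup (f := id) hx)
    rw [ht' x hlt]
    simpa [hlt] using (hu x hx).2

/-- Baire category in `ℕ → Bool`: meeting `H n`, and not computing `f` by the program `P`, are open
dense conditions on `t`, and there are countably many of them. -/
theorem exists_restrict_avoiding {X : Set (ℕ → ℕ)} (hX : Closed X) (hcount : X.Countable)
    {f : ℕ → ℕ} (hf : f ∉ X) (w : ℕ → ℕ) (H : ℕ → Set ℕ) (hH : ∀ n, (H n).Infinite) :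
    ∃ t : ℕ → Bool, (∀ n, ∃ x ∈ H n, t x = true) ∧ f ∉ closure (adjoin X (restrict w t)) := by
  have := hcount.to_subtype
  let ev (P : Prog (Option X) 1) (t : ℕ → Bool) (x : ℕ) : ℕ :=
    P.eval (adjoin X (restrict w t)) fun _ => x
  let U : ℕ ⊕ Prog (Option X) 1 → Set (ℕ → Bool) := fun i => i.elim
    (fun n => {t | ∃ x ∈ H n, t x = true}) fun P => {t | ∃ x, ev P t x ≠ f x}
  have hopen : ∀ i, IsOpen (U i) := by
    rintro (n | P)
    · have : U (.inl n) = ⋃ x ∈ H n, {t | t x = true} := by ext; simp [U]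
      rw [this]
      exact isOpen_biUnion fun x _ =>
        (isOpen_discrete ({true} : Set Bool)).preimage (continuous_apply (A := fun _ => Bool) x)
    · have : U (.inr P) = ⋃ x, {t | ev P t x ≠ f x} := by ext; simp [U]
      rw [this]
      refine isOpen_iUnion fun x => (isOpen_discrete {y | y ≠ f x}).preimage ?_
      refine Prog.continuous_eval (fun j y => ?_) P _ fun _ => continuous_const
      cases j with
      | none =>
        exact (continuous_of_discreteTopology (f := fun b : Bool => if b then w y else 0)).comp
          (continuous_apply y)
      | some g => exact continuous_const
  have hdense : ∀ i, Dense (U i) := by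
    intro i
    refine dense_iff_inter_open.2 fun V hV hne => ?_
    obtain ⟨t, N, ht, hV⟩ := exists_agree_finite V hV hne
    rcases i with n | P
    -- An element of `H n` beyond the finite condition can be switched on without leaving `V`.
    · obtain ⟨a, ha, hlt⟩ := (hH n).exists_gt N
      refine ⟨Function.update t a true, hV _ fun x hx => ?_, a, ha, by simp⟩
      rw [Function.update_of_ne (by omega)]
    -- With finitely supported `t` all oracles of `P` lie in `X`; if `P` computed `f`, then `f`
    -- would lie in `X`.
    · refine ⟨t, hV t fun _ _ => rfl, by_contra fun hcon => hf ?_⟩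
      have hP : (fun x => ev P t x) = f := funext fun x => by
        by_contra h
        exact hcon ⟨x, h⟩
      rw [← hP]
      refine hX.eval_mem (fun j => ?_) P
      cases j with
      | none => exact hX.mem_of_eventually_zero (N := N) fun x hx => by simp [adjoin, restrict, ht x hx]
      | some g => exact g.2
  obtain ⟨t, ht⟩ := (dense_iInter_of_isOpen hopen hdense).nonempty
  rw [mem_iInter] at ht
  refine ⟨t, fun n => ht (.inl n), ?_⟩
  rintro ⟨P, hP⟩
  obtain ⟨x, hx⟩ := ht (.inr P)
  exact hx (congrFun hP x)

/-- A countable class of functions closed under primitive recursion that omits `f`. -/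
structure Omits (f : ℕ → ℕ) (X : Set (ℕ → ℕ)) : Prop where
  closed : Closed X
  countable : X.Countable
  not_mem : f ∉ X

theorem Omits.iUnion {f : ℕ → ℕ} {X : ℕ → Set (ℕ → ℕ)} (hX : Monotone X)
    (h : ∀ i, Omits f (X i)) : Omits f (⋃ i, X i) where
  closed := Closed.iUnion hX fun i => (h i).closed
  countable := countable_iUnion fun i => (h i).countable
  not_mem hf := let ⟨i, hi⟩ := mem_iUnion.1 hf; (h i).not_mem hi

theorem Omits.exists_restrict {f : ℕ → ℕ} {X : Set (ℕ → ℕ)} (hX : Omits f X) (w : ℕ → ℕ)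
    (H : ℕ → Set ℕ) (hH : ∀ n, (H n).Infinite) :
    ∃ t : ℕ → Bool, (∀ n, ∃ x ∈ H n, t x = true) ∧ ∃ Y, Omits f Y ∧ X ⊆ Y ∧ restrict w t ∈ Y := by
  have := hX.countable.to_subtype
  obtain ⟨t, ht, hf⟩ := exists_restrict_avoiding hX.closed hX.countable hX.not_mem w H hH
  exact ⟨t, ht, _, ⟨closed_closure _, countable_closure _, hf⟩,
    fun g hg => mem_closure (adjoin X (restrict w t)) (some ⟨g, hg⟩),
    mem_closure (adjoin X (restrict w t)) none⟩

/-- `h` is a solution of the colouring `c` of the `n`-element sets. -/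
def Solves (n : ℕ) (c h : ℕ → ℕ) : Prop :=
  ((∀ x, h x = 0 ∨ h x = 1) ∧ ∀ m, ∃ x, m < x ∧ h x = 1) ∧
    ∃ i, ∀ x : Fin n → ℕ, StrictMono x → (∀ j, h (x j) = 1) → c (tupleCode n x) = i

/-! ### Closing a class under solutions of colourings -/

theorem Omits.exists_solves {f : ℕ → ℕ} {X : Set (ℕ → ℕ)} (hX : Omits f X) (n k : ℕ) (c : ℕ → ℕ) :
    ∃ Y, Omits f Y ∧ X ⊆ Y ∧
      ((∀ x : Fin n → ℕ, StrictMono x → c (tupleCode n x) < k) → ∃ h ∈ Y, Solves n c h) := by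
  by_cases hc : ∀ x : Fin n → ℕ, StrictMono x → c (tupleCode n x) < k
  swap
  · exact ⟨X, hX, subset_rfl, fun h => absurd h hc⟩
  -- The bound on colours holds only at increasing tuples; `none` is a dummy colour for the others.
  obtain ⟨H, -, hH, i, hi⟩ := ramsey n
    (fun x => if h : c (tupleCode n x) < k then some (⟨_, h⟩ : Fin k) else none) univ infinite_univ
  classical
  -- Meeting every tail of `H` keeps the thinned set unbounded.
  obtain ⟨t, ht, Y, hY, hXY, hmem⟩ := hX.exists_restrict (fun x => if x ∈ H then 1 else 0)
    (fun m => H ∩ Ioi m) fun m => infinite_of_not_bddAbove fun ⟨b, hb⟩ => by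
      obtain ⟨a, ha, hlt⟩ := hH.exists_gt (max m b)
      exact absurd (hb ⟨ha, lt_of_le_of_lt (le_max_left _ _) hlt⟩)
        (not_le.2 (lt_of_le_of_lt (le_max_right _ _) hlt))
  refine ⟨Y, hY, hXY, fun _ => ⟨_, hmem, ⟨fun x => ?_, fun m => ?_⟩, ?_⟩⟩
  · unfold restrict
    split_ifs <;> simp [em']
  · obtain ⟨x, ⟨hx, hlt⟩, htx⟩ := ht m
    exact ⟨x, hlt, by simp [restrict, htx, hx]⟩
  · refine ⟨(i.map Fin.val).getD 0, fun x hx hxt => ?_⟩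
    have hxH : ∀ j, x j ∈ H := fun j => by
      by_contra hj
      have := hxt j
      simp [restrict, hj] at this
    rw [← hi x hx hxH, dif_pos (hc x hx)]
    rfl

theorem Omits.exists_solves_all {f : ℕ → ℕ} {X : Set (ℕ → ℕ)} (hX : Omits f X) (n k : ℕ) :
    ∃ Y, Omits f Y ∧ X ⊆ Y ∧ ∀ c ∈ X,
      (∀ x : Fin n → ℕ, StrictMono x → c (tupleCode n x) < k) → ∃ h ∈ Y, Solves n c h := by
  have hne : X.Nonempty := ⟨_, hX.closed (.comp .zero ![])⟩
  obtain ⟨e, he⟩ := hX.countable.exists_eq_range hne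
  choose Y hY hXY hsol using fun (Z : {Z // Omits f Z}) c => Z.2.exists_solves n k c
  let S : ℕ → {Z // Omits f Z} := fun i => Nat.rec ⟨X, hX⟩ (fun i Z => ⟨Y Z (e i), hY Z (e i)⟩) i
  have hmono : Monotone fun i => (S i).1 := monotone_nat_of_le_succ fun i => hXY (S i) (e i)
  refine ⟨⋃ i, (S i).1, .iUnion hmono fun i => (S i).2, subset_iUnion_of_subset 0 subset_rfl, ?_⟩
  intro c hcX hc
  rw [he] at hcX
  obtain ⟨i, rfl⟩ := hcX
  obtain ⟨h, hh, hs⟩ := hsol (S i) (e i) hc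
  exact ⟨h, mem_iUnion.2 ⟨i + 1, hh⟩, hs⟩

/-- Each colouring in the union appears at some stage and is solved at the next one. -/
theorem Omits.exists_RT {f : ℕ → ℕ} {X : Set (ℕ → ℕ)} (hX : Omits f X) (n k : ℕ) :
    ∃ Y, Omits f Y ∧ X ⊆ Y ∧ (Struc.omega Y).RT n k := by
  choose Y hY hXY hsol using fun Z : {Z // Omits f Z} => Z.2.exists_solves_all n k
  let S : ℕ → {Z // Omits f Z} := fun i => Nat.rec ⟨X, hX⟩ (fun _ Z => ⟨Y Z, hY Z⟩) i
  have hmono : Monotone fun i => (S i).1 := monotone_nat_of_le_succ fun i => hXY (S i)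
  refine ⟨⋃ i, (S i).1, .iUnion hmono fun i => (S i).2, subset_iUnion_of_subset 0 subset_rfl, ?_⟩
  intro c hcX hc
  obtain ⟨i, hi⟩ := mem_iUnion.1 hcX
  obtain ⟨h, hh, hs⟩ := hsol (S i) c hi ((Struc.omega_isColouring _ n k c).1 hc)
  exact ⟨h, mem_iUnion.2 ⟨i + 1, hh⟩, (Struc.omega_isInfiniteSet _ h).2 hs.1,
    (Struc.omega_isHomogeneous _ n c h).2 hs.2⟩

/-! ### A set that is computable but not primitive recursive relative to a sparse function -/

theorem exists_omits :
    ∃ (A : ℕ → ℕ) (g : ℕ → ℕ) (X : Set (ℕ → ℕ)), Omits A X ∧ g ∈ X ∧ (∀ n, A n = 0 ∨ A n = 1) ∧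
      ∀ n, (∃ x, g x = 2 * n + 1 + A n) ∧ ∀ x b, b ≤ 1 → g x = 2 * n + 1 + b → b = A n := by
  let F : Empty → ℕ → ℕ := Empty.elim
  obtain ⟨e, he⟩ := (countable_closure F).exists_eq_range ⟨_, .comp .zero ![], rfl⟩
  -- Cantor's diagonal against an enumeration of the primitive recursive functions.
  let A : ℕ → ℕ := fun n => if e n n = 0 then 1 else 0
  have hA01 : ∀ n, A n = 0 ∨ A n = 1 := fun n => by simp only [A]; split_ifs <;> simp
  have hA : Omits A (closure F) := ⟨closed_closure F, countable_closure F, fun h => by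
    rw [he] at h
    obtain ⟨n, hn⟩ := h
    have := congrFun hn n
    simp only [A] at this
    split_ifs at this <;> omega⟩
  -- The value `2 * n + 1 + A n` announces `A n`, and `0` announces nothing. Each `n` may be
  -- announced anywhere in an infinite column, so a sparse `t` still announces all of `A`.
  obtain ⟨t, ht, Y, hY, -, hg⟩ := hA.exists_restrict (fun x => 2 * x.unpair.1 + 1 + A x.unpair.1)
    (fun n => {x | x.unpair.1 = n}) fun n => by
      refine infinite_of_injective_forall_mem (f := fun i => Nat.pair n i) (fun i j h => ?_) ?_
      · simpa using h
      · simp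
  refine ⟨A, _, Y, hY, hg, hA01, fun n => ⟨?_, fun x b hb hx => ?_⟩⟩
  · obtain ⟨x, hx, htx⟩ := ht n
    exact ⟨x, by simp only [mem_ofPred_eq] at hx; simp [restrict, htx, hx]⟩
  · unfold restrict at hx
    split_ifs at hx
    swap
    · omega
    simp only at hx
    have h1 := hA01 x.unpair.1
    have : x.unpair.1 = n := by omega
    rw [this] at hx
    omega

theorem not_delta01CA {A g : ℕ → ℕ} {X : Set (ℕ → ℕ)} (hA : A ∉ X) (hg : g ∈ X)
    (hA01 : ∀ n, A n = 0 ∨ A n = 1)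
    (h : ∀ n, (∃ x, g x = 2 * n + 1 + A n) ∧ ∀ x b, b ≤ 1 → g x = 2 * n + 1 + b → b = A n) :
    ¬ (Struc.omega X).Delta01CA := by
  intro hCA
  -- Variable `0` is the quantified position `y` and variable `1` is `x`, so `u` denotes `2 * x +
  -- 1`. Thus `φ` says that `A x = 1` is announced somewhere, and `ψ` that `A x = 0` is announced
  -- nowhere.
  let u : Term 1 2 := .sym (k := 0) .succ ![] ![.sym (k := 0) .add ![] ![.var 1, .var 1]]
  let φ : Formula 1 1 := .ex (.eq (.app 0 (.var 0)) (.sym (k := 0) .succ ![] ![u]))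
  let ψ : Formula 1 1 := .all (.neg (.eq (.app 0 (.var 0)) u))
  let G : Fin 1 → (Struc.omega X).fn := fun _ => ⟨g, hg⟩
  have hu : ∀ (y x : ℕ) (p : Fin 0 → ℕ),
      (Struc.omega X).val G (Fin.cons y (Fin.cons x p)) u = 2 * x + 1 := fun y x p => by
    exact (congrArg Nat.succ (Scheme.eval_add (k := 0) _ _)).trans
      (show x + x + 1 = 2 * x + 1 by omega)
  have hφ : ∀ (x : ℕ) (p : Fin 0 → ℕ), (Struc.omega X).Sat G (Fin.cons x p) φ ↔ A x = 1 := by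
    intro x p
    have : (Struc.omega X).Sat G (Fin.cons x p) φ ↔ ∃ y, g y = 2 * x + 1 + 1 :=
      exists_congr fun y => by
        rw [← hu y x p]; rfl
    rw [this]
    refine ⟨fun ⟨y, hy⟩ => ((h x).2 y 1 le_rfl hy).symm, fun hx => ?_⟩
    simpa only [hx] using (h x).1
  have hψ : ∀ (x : ℕ) (p : Fin 0 → ℕ), (Struc.omega X).Sat G (Fin.cons x p) ψ ↔ A x = 1 := by
    intro x p
    have : (Struc.omega X).Sat G (Fin.cons x p) ψ ↔ ∀ y, ¬ g y = 2 * x + 1 :=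
      forall_congr' fun y => by
        rw [← hu y x p]; rfl
    rw [this]
    refine ⟨fun hx => (hA01 x).resolve_left fun h0 => ?_, fun hx y hy => ?_⟩
    · obtain ⟨y, hy⟩ := (h x).1
      exact hx y (by rw [hy, h0])
    · have := (h x).2 y 0 zero_le_one hy
      omega
  obtain ⟨f, hf, hfx⟩ := hCA φ ψ (.ex (.delta0 (.eq _ _))) (.all (.delta0 (.neg (.eq _ _)))) G ![]
    fun x => (hφ x _).trans (hψ x _).symm
  refine hA ((show f = A from ?_) ▸ hf)
  funext x
  rcases hA01 x with h0 | h0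
  · rw [h0]
    exact ((hfx x).2 fun hx => by have := (hφ x _).1 hx; omega).trans (Struc.omega_num X 0)
  · rw [h0]
    exact ((hfx x).1 ((hφ x _).2 h0)).trans (Struc.omega_num X 1)

theorem not_RT_implies_delta01CA (n k : ℕ) :
    ¬ ImpliesStandard (fun S => S.RT n k) fun S => S.Delta01CA := by
  obtain ⟨A, g, X, hX, hg, hA01, h⟩ := exists_omits
  obtain ⟨Y, hY, hXY, hRT⟩ := hX.exists_RT n k
  exact fun hI => not_delta01CA hY.not_mem (hXY hg) hA01 h
    (hI _ ⟨Y, rfl⟩ hY.closed.isModel hRT)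

end PRA2

namespace PRA2

/-! ### Computable functions of several variables -/

section Computable

variable {α : Type} [Primcodable α]

theorem computable_pi {σ : Type} [Primcodable σ] {n : ℕ} {f : Fin n → α → σ}
    (hf : ∀ i, Computable (f i)) : Computable fun a i => f i a :=
  (Primrec.vector_get'.to_comp.comp (Computable.vector_ofFn hf)).of_eq fun a => by
    funext i
    simp

theorem computable_apply {n : ℕ} (i : Fin n) {f : α → Fin n → ℕ} (hf : Computable f) :
    Computable fun a => f a i :=
  Computable.fin_app.comp hf (Computable.const _)

theorem computable_tail {n : ℕ} {f : α → Fin (n + 1) → ℕ} (hf : Computable f) :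
    Computable fun a => (Fin.tail (f a) : Fin n → ℕ) :=
  computable_pi fun i => computable_apply i.succ hf

theorem computable_cons {n : ℕ} {f : α → ℕ} {g : α → Fin n → ℕ} (hf : Computable f)
    (hg : Computable g) : Computable fun a => (Fin.cons (f a) (g a) : Fin (n + 1) → ℕ) := by
  have h : ∀ i : Fin (n + 1), Computable fun a => (Fin.cons (f a) (g a) : Fin (n + 1) → ℕ) i := by
    refine Fin.cases ?_ fun i => ?_
    · exact hf
    · exact computable_apply i hg
  exact computable_pi h

theorem Scheme.computable_eval {k m : ℕ} {F : Fin k → ℕ → ℕ} (hF : ∀ j, Computable (F j))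
    (P : Scheme k m) : Computable fun v : Fin m → ℕ => P.eval F v := by
  induction P with
  | zero => exact Computable.const 0
  | succ => exact Computable.succ.comp (computable_apply 0 Computable.id)
  | proj i => exact computable_apply i Computable.id
  | oracle j => exact (hF j).comp (computable_apply 0 Computable.id)
  | comp g h ihg ihh => exact ihg.comp (computable_pi ihh)
  | prec g h ihg ihh =>
    exact Computable.nat_rec (computable_apply 0 Computable.id)
      (ihg.comp (computable_tail Computable.id))
      (ihh.comp (computable_cons (Computable.fst.comp Computable.snd)
        (computable_cons (Computable.snd.comp Computable.snd)
          (computable_tail Computable.fst)))).to₂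

/-- Unbounded search for a witness of a decidable relation. -/
theorem exists_computable_choice {p : α → ℕ → Bool} (hp : Computable₂ p) (h : ∀ a, ∃ y, p a y) :
    ∃ f : α → ℕ, Computable f ∧ ∀ a, p a (f a) := by
  have hdom : ∀ a, (Nat.rfind fun y => Part.some (p a y)).Dom := fun a => by
    obtain ⟨y, hy⟩ := h a
    obtain ⟨z, hz, -⟩ := Nat.rfind_min' (p := p a) hy
    exact Part.dom_iff_mem.2 ⟨z, hz⟩
  have hpart : Partrec fun a => Nat.rfind fun y => Part.some (p a y) := Partrec.rfind hp.partrec₂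
  refine ⟨fun a => (Nat.rfind fun y => Part.some (p a y)).get (hdom a),
    hpart.of_eq_tot fun a => Part.get_mem _, fun a => ?_⟩
  have := Nat.rfind_spec (Part.get_mem (hdom a))
  exact (Part.mem_some_iff.1 this).symm

end Computable

/-! ### The class of computable functions -/

/-- The class of computable unary functions. -/
def computableFns : Set (ℕ → ℕ) := {f | Computable f}

/-- The standard structure whose functions are the computable ones. -/
abbrev compStruc : Struc := Struc.omega computableFns

theorem compStruc_isModel : compStruc.IsModel :=
  Struc.omega_isModel _ fun P F p =>
    (Scheme.computable_eval (fun j => (F j).2) P).comp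
      (computable_cons Computable.id (Computable.const p))

/-- The value of a term in `compStruc`, as a natural number. -/
def compVal {b a : ℕ} (F : Fin b → computableFns) (t : Term b a) (p : Fin a → ℕ) : ℕ :=
  compStruc.val F p t

theorem computable_compVal {b a : ℕ} (F : Fin b → computableFns) (t : Term b a) :
    Computable (compVal F t) := by
  induction t with
  | var i => exact computable_apply i Computable.id
  | app f t ih => exact (F f).2.comp ih
  | sym P f t ih =>
    exact (Scheme.computable_eval (fun j => (F (f j)).2) P).comp
      (computable_pi (f := fun i => compVal F (t i)) ih)

theorem exists_decide_lt {a : ℕ} {t : (Fin a → ℕ) → ℕ} (ht : Computable t)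
    {d : (Fin (a + 1) → ℕ) → Bool} (hd : Computable d) :
    ∃ e : (Fin a → ℕ) → Bool, Computable e ∧ ∀ p, e p ↔ ∃ x < t p, d (Fin.cons x p) := by
  refine ⟨fun p => Nat.rec false (fun x r => r || d (Fin.cons x p)) (t p),
    Computable.nat_rec ht (Computable.const false)
      (Primrec.or.to_comp.comp (Computable.snd.comp Computable.snd)
        (hd.comp (computable_cons (Computable.fst.comp Computable.snd) Computable.fst))).to₂,
    fun p => ?_⟩
  beta_reduce
  generalize t p = n
  induction n with
  | zero => simp
  | succ n ih =>
    rw [Bool.or_eq_true, ih]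
    simp only [Nat.lt_succ_iff_lt_or_eq]
    constructor
    · rintro (⟨x, hx, h⟩ | h)
      exacts [⟨x, .inl hx, h⟩, ⟨n, .inr rfl, h⟩]
    · rintro ⟨x, hx | rfl, h⟩
      exacts [.inl ⟨x, hx, h⟩, .inr h]

theorem exists_decide_of_isDelta0 {b a : ℕ} (F : Fin b → computableFns) {φ : Formula b a}
    (hφ : φ.IsDelta0) :
    ∃ d : (Fin a → ℕ) → Bool, Computable d ∧ ∀ p : Fin a → ℕ, d p ↔ compStruc.Sat F p φ := by
  induction hφ with
  | eq t u =>
    exact ⟨fun p => decide (compVal F t p = compVal F u p),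
      Primrec.eq.decide.to_comp.comp (computable_compVal F t) (computable_compVal F u),
      fun p => decide_eq_true_iff⟩
  | lt t u =>
    exact ⟨fun p => decide (compVal F t p < compVal F u p),
      Primrec.nat_lt.decide.to_comp.comp (computable_compVal F t) (computable_compVal F u),
      fun p => decide_eq_true_iff⟩
  | neg _ ih =>
    obtain ⟨d, hd, h⟩ := ih
    exact ⟨_, Primrec.not.to_comp.comp hd, fun p => by
      rw [Bool.not_eq_true', ← Bool.not_eq_true]; exact not_congr (h p)⟩
  | and _ _ ih₁ ih₂ =>
    obtain ⟨d, hd, h⟩ := ih₁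
    obtain ⟨e, he, h'⟩ := ih₂
    exact ⟨_, Primrec.and.to_comp.comp hd he, fun p => by
      rw [Bool.and_eq_true]; exact and_congr (h p) (h' p)⟩
  | or _ _ ih₁ ih₂ =>
    obtain ⟨d, hd, h⟩ := ih₁
    obtain ⟨e, he, h'⟩ := ih₂
    exact ⟨_, Primrec.or.to_comp.comp hd he, fun p => by
      rw [Bool.or_eq_true]; exact or_congr (h p) (h' p)⟩
  | imp _ _ ih₁ ih₂ =>
    obtain ⟨d, hd, h⟩ := ih₁
    obtain ⟨e, he, h'⟩ := ih₂
    exact ⟨_, Primrec.or.to_comp.comp (Primrec.not.to_comp.comp hd) he, fun p => by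
      rw [Bool.or_eq_true, Bool.not_eq_true', ← Bool.not_eq_true, ← imp_iff_not_or]
      exact imp_congr (h p) (h' p)⟩
  | ball t _ ih =>
    obtain ⟨d, hd, h⟩ := ih
    obtain ⟨e, he, h'⟩ := exists_decide_lt (computable_compVal F t) (Primrec.not.to_comp.comp hd)
    refine ⟨_, Primrec.not.to_comp.comp he, fun p => ?_⟩
    rw [Bool.not_eq_true', ← Bool.not_eq_true, h' p]
    push Not
    refine forall₂_congr fun x _ => ?_
    refine Iff.trans ?_ (h _)
    simp only [ne_eq, Bool.not_eq_true', Bool.not_eq_false]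
    rfl
  | bex t _ ih =>
    obtain ⟨d, hd, h⟩ := ih
    obtain ⟨e, he, h'⟩ := exists_decide_lt (computable_compVal F t) hd
    exact ⟨e, he, fun p => (h' p).trans (exists_congr fun x => and_congr_right fun _ => h _)⟩

/-- Pairing contracts two unbounded quantifiers to one, so that a quantifier block becomes a single
search. -/
theorem exists_decide_unpair {a : ℕ} {d : (Fin (a + 2) → ℕ) → Bool} (hd : Computable d) :
    ∃ e : (Fin (a + 1) → ℕ) → Bool, Computable e ∧ ∀ (p : Fin a → ℕ),
      (∃ y, e (Fin.cons y p)) ↔ ∃ x y, d (Fin.cons y (Fin.cons x p)) := by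
  have hu : Computable fun v : Fin (a + 1) → ℕ => (v 0).unpair :=
    Computable.unpair.comp (computable_apply 0 Computable.id)
  refine ⟨fun v => d (Fin.cons (v 0).unpair.2 (Fin.cons (v 0).unpair.1 (Fin.tail v))),
    hd.comp (computable_cons (Computable.snd.comp hu) (computable_cons (Computable.fst.comp hu)
      (computable_tail Computable.id))), fun p => ⟨fun ⟨y, hy⟩ => ⟨_, _, hy⟩, ?_⟩⟩
  rintro ⟨x, y, h⟩
  exact ⟨Nat.pair x y, by simpa using h⟩

theorem exists_search_of_isSigma1 {b a : ℕ} (F : Fin b → computableFns) {φ : Formula b a}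
    (hφ : φ.IsSigma1) :
    ∃ d : (Fin (a + 1) → ℕ) → Bool, Computable d ∧
      ∀ p : Fin a → ℕ, compStruc.Sat F p φ ↔ ∃ y, d (Fin.cons y p) := by
  induction hφ with
  | delta0 hφ =>
    obtain ⟨d, hd, h⟩ := exists_decide_of_isDelta0 F hφ
    exact ⟨_, hd.comp (computable_tail Computable.id), fun p => by simp [← h, Fin.tail_cons]⟩
  | ex _ ih =>
    obtain ⟨d, hd, h⟩ := ih
    obtain ⟨e, he, h'⟩ := exists_decide_unpair hd
    exact ⟨e, he, fun p => (exists_congr fun x => h _).trans (h' p).symm⟩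

theorem exists_search_of_isPi1 {b a : ℕ} (F : Fin b → computableFns) {φ : Formula b a}
    (hφ : φ.IsPi1) :
    ∃ d : (Fin (a + 1) → ℕ) → Bool, Computable d ∧
      ∀ p : Fin a → ℕ, ¬ compStruc.Sat F p φ ↔ ∃ y, d (Fin.cons y p) := by
  induction hφ with
  | delta0 hφ =>
    obtain ⟨d, hd, h⟩ := exists_decide_of_isDelta0 F hφ
    exact ⟨_, Primrec.not.to_comp.comp (hd.comp (computable_tail Computable.id)), fun p => by
      simp [← h, Fin.tail_cons]⟩
  | all _ ih =>
    obtain ⟨d, hd, h⟩ := ih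
    obtain ⟨e, he, h'⟩ := exists_decide_unpair hd
    exact ⟨e, he, fun p => not_forall.trans ((exists_congr fun x => h _).trans (h' p).symm)⟩

/-- One searches simultaneously for a witness of `φ` and a counterexample to `ψ`. The equivalence
makes the search total and excludes having both, so the kind of witness found decides `φ`. -/
theorem compStruc_delta01CA : compStruc.Delta01CA := by
  intro b a φ ψ hφ hψ F (p : Fin a → ℕ) heq
  obtain ⟨d, hd, h⟩ := exists_search_of_isSigma1 F hφ
  obtain ⟨e, he, h'⟩ := exists_search_of_isPi1 F hψ
  have hcons : Computable fun q : ℕ × ℕ => (Fin.cons q.2 (Fin.cons q.1 p) : Fin (a + 2) → ℕ) :=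
    computable_cons Computable.snd (computable_cons Computable.fst (Computable.const p))
  obtain ⟨f, hf, hfx⟩ := exists_computable_choice
    (p := fun x y => d (Fin.cons y (Fin.cons x p)) || e (Fin.cons y (Fin.cons x p)))
    (Primrec.or.to_comp.comp (hd.comp hcons) (he.comp hcons)).to₂ fun x => by
      by_cases hx : compStruc.Sat F (Fin.cons x p) φ
      · obtain ⟨y, hy⟩ := (h _).1 hx
        exact ⟨y, by rw [Bool.or_eq_true]; exact .inl hy⟩
      · obtain ⟨y, hy⟩ := (h' _).1 fun hx' => hx ((heq x).2 hx')
        exact ⟨y, by rw [Bool.or_eq_true]; exact .inr hy⟩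
  have hc := hd.comp (hcons.comp (Computable.id.pair hf))
  refine ⟨_, Computable.cond hc (Computable.const 1) (Computable.const 0), fun x => ⟨?_, ?_⟩⟩
  · intro hx
    rw [Struc.omega_num _ 1]
    rcases (Bool.or_eq_true _ _).mp (hfx x) with hy | hy
    · exact congrArg (fun b => (cond b 1 0 : ℕ)) hy
    · exact absurd ((heq x).1 hx) ((h' _).2 ⟨_, hy⟩)
  · intro hx
    rw [Struc.omega_num _ 0]
    refine congrArg (fun b => (cond b 1 0 : ℕ)) (Bool.eq_false_iff.2 fun hy => hx ((h _).2 ⟨_, hy⟩))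

end PRA2

namespace PRA2

open Nat.Partrec (Code)

/-! ### A computable colouring of pairs without computable homogeneous sets -/

/-- The `e`-th partial computable function takes the value `1` at `x` within `s` steps. -/
def Visible (s e x : ℕ) : Prop := Code.evaln s (Denumerable.ofNat Code e) x = some 1

instance (s e : ℕ) : DecidablePred (Visible s e) := fun _ => inferInstanceAs (Decidable (_ = _))

/-- The colour of `x` in the colouring of the numbers coded by `z`. -/
def colour (z x : ℕ) : ℕ := (Denumerable.ofNat (List ℕ) z).getD x 0

/-- The elements below `s` that are visible at stage `s`. -/
def visibleList (s e : ℕ) : List ℕ := (List.range s).filter fun x => Visible s e x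

/-- The colouring coded by `z` splits each of the first `s` sets that have sufficiently many
visible elements. -/
def Splits (s z : ℕ) : Prop :=
  ∀ e < s, (visibleList s e).length < 2 * e + 2 ∨
    ∃ x ∈ visibleList s e, ∃ y ∈ visibleList s e, colour z x = 0 ∧ colour z y = 1

theorem primrec_visibleList : Primrec₂ visibleList := by
  have hR : PrimrecRel fun (x : ℕ) (q : ℕ × ℕ) => Visible q.1 q.2 x :=
    Primrec.eq.comp
      (Code.primrec_evaln.comp (((Primrec.fst.comp Primrec.snd).pair
        ((Primrec.ofNat Code).comp (Primrec.snd.comp Primrec.snd))).pair Primrec.fst))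
      (Primrec.const (some 1))
  exact hR.listFilter.comp (Primrec.list_range.comp Primrec.fst) Primrec.id

theorem primrec_colour : Primrec₂ colour :=
  (Primrec.list_getD 0).comp ((Primrec.ofNat (List ℕ)).comp Primrec.fst) Primrec.snd

theorem primrecRel_splits : PrimrecRel Splits := by
  have hc : ∀ i : ℕ, PrimrecRel fun (x : ℕ) (z : ℕ) => colour z x = i := fun i =>
    Primrec.eq.comp (primrec_colour.comp Primrec.snd Primrec.fst) (Primrec.const i)
  have hex : ∀ i : ℕ, PrimrecRel fun (L : List ℕ) (z : ℕ) => ∃ x ∈ L, colour z x = i := fun i =>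
    (hc i).exists_mem_list
  have h : PrimrecRel fun (e : ℕ) (q : ℕ × ℕ) => (visibleList q.1 e).length < 2 * e + 2 ∨
      ((∃ x ∈ visibleList q.1 e, colour q.2 x = 0) ∧ ∃ x ∈ visibleList q.1 e, colour q.2 x = 1) := by
    have hL : Primrec fun p : ℕ × ℕ × ℕ => visibleList p.2.1 p.1 :=
      primrec_visibleList.comp (Primrec.fst.comp Primrec.snd) Primrec.fst
    have hz : Primrec fun p : ℕ × ℕ × ℕ => p.2.2 := Primrec.snd.comp Primrec.snd
    refine PrimrecPred.or (Primrec.nat_lt.comp (Primrec.list_length.comp hL) ?_)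
      (((hex 0).comp hL hz).and ((hex 1).comp hL hz))
    exact Primrec.nat_add.comp (Primrec.nat_double.comp Primrec.fst) (Primrec.const 2)
  refine (h.forall_mem_list.comp (Primrec.list_range.comp Primrec.fst) Primrec.id).of_eq
    fun q => ?_
  refine forall_congr' fun e => imp_congr List.mem_range (or_congr_right ?_)
  constructor
  · rintro ⟨⟨x, hx, h0⟩, y, hy, h1⟩
    exact ⟨x, hx, y, hy, h0, h1⟩
  · rintro ⟨x, hx, y, hy, h0, h1⟩
    exact ⟨⟨x, hx, h0⟩, y, hy, h1⟩

/-- Greedy choice: before `V n` is treated at most `2 * n` points are in use, so `2 * n + 2`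
elements leave two fresh ones, one for each side. -/
theorem exists_disjoint_splitting (V : ℕ → Finset ℕ) (n : ℕ) :
    ∃ A B : Finset ℕ, Disjoint A B ∧ A.card ≤ n ∧ B.card ≤ n ∧
      ∀ e < n, 2 * e + 2 ≤ (V e).card → (∃ x ∈ V e, x ∈ A) ∧ ∃ y ∈ V e, y ∈ B := by
  induction n with
  | zero => exact ⟨∅, ∅, by simp⟩
  | succ n ih =>
    obtain ⟨A, B, hd, hA, hB, h⟩ := ih
    by_cases hV : 2 * n + 2 ≤ (V n).card
    · have h1 : 1 < (V n \ (A ∪ B)).card := by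
        have := Finset.le_card_sdiff (A ∪ B) (V n)
        have := Finset.card_union_le A B
        omega
      obtain ⟨x, hx, y, hy, hxy⟩ := Finset.one_lt_card.1 h1
      simp only [Finset.mem_sdiff, Finset.mem_union, not_or] at hx hy
      refine ⟨insert x A, insert y B, ?_, (Finset.card_insert_le _ _).trans (by omega),
        (Finset.card_insert_le _ _).trans (by omega), fun e he hVe => ?_⟩
      · simp [Finset.disjoint_insert_left, Finset.disjoint_insert_right, hd, hx, hy, hxy.symm]
      · rcases Nat.lt_succ_iff_lt_or_eq.1 he with he | rfl
        · obtain ⟨⟨a, ha, ha'⟩, b, hb, hb'⟩ := h e he hVe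
          exact ⟨⟨a, ha, Finset.mem_insert_of_mem ha'⟩, b, hb, Finset.mem_insert_of_mem hb'⟩
        · exact ⟨⟨x, hx.1, Finset.mem_insert_self _ _⟩, y, hy.1, Finset.mem_insert_self _ _⟩
    · refine ⟨A, B, hd, by omega, by omega, fun e he hVe => ?_⟩
      rcases Nat.lt_succ_iff_lt_or_eq.1 he with he | rfl
      · exact h e he hVe
      · exact absurd hVe hV

theorem mem_visibleList {s e x : ℕ} : x ∈ visibleList s e ↔ x < s ∧ Visible s e x := by
  simp [visibleList]

/-- This guarantees that the search for a splitting colouring halts at every stage. -/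
theorem exists_splits (s : ℕ) : ∃ z, Splits s z := by
  classical
  obtain ⟨A, B, hd, -, -, h⟩ := exists_disjoint_splitting (fun e => (visibleList s e).toFinset) s
  refine ⟨Encodable.encode ((List.range s).map fun x => if x ∈ B then 1 else 0), fun e he => ?_⟩
  have hcol : ∀ x < s, colour (Encodable.encode ((List.range s).map fun x =>
      if x ∈ B then 1 else 0)) x = if x ∈ B then 1 else 0 := fun x hx => by
    simp [colour, List.getD_eq_getElem?_getD, hx]
  refine or_iff_not_imp_left.2 fun hlen => ?_
  have hnd : (visibleList s e).Nodup := List.nodup_range.filter _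
  obtain ⟨⟨x, hx, hxA⟩, y, hy, hyB⟩ := h e he (by rw [List.toFinset_card_of_nodup hnd]; omega)
  rw [List.mem_toFinset] at hx hy
  refine ⟨x, hx, y, hy, ?_, ?_⟩
  · rw [hcol x (mem_visibleList.1 hx).1, if_neg (Finset.disjoint_left.1 hd hxA)]
  · rw [hcol y (mem_visibleList.1 hy).1, if_pos hyB]

/-- If `e` is an index of `h`, then at a late stage `2 * e + 2` elements of the set are visible, so
the splitting requirement for `e` is active. The stage can be taken inside the set, which is what
turns it into the second element of a pair. -/
theorem exists_stage_splitting (h : ℕ → ℕ) (hh : Computable h) (hinf : ∀ m, ∃ x, m < x ∧ h x = 1) :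
    ∃ s, h s = 1 ∧ ∀ z, Splits s z →
      ∃ x < s, ∃ y < s, h x = 1 ∧ h y = 1 ∧ colour z x = 0 ∧ colour z y = 1 := by
  obtain ⟨c, hc⟩ := Code.exists_code.1 (Partrec.nat_iff.1 hh.partrec)
  have hsound : ∀ {s x}, Visible s (Encodable.encode c) x → h x = 1 := fun {s x} hv => by
    unfold Visible at hv
    rw [Denumerable.ofNat_encode] at hv
    have := Code.evaln_sound hv
    rw [hc] at this
    exact (Part.mem_some_iff.1 this).symm
  have hcomplete : ∀ x, h x = 1 → ∃ s, Visible s (Encodable.encode c) x := fun x hx => by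
    have : 1 ∈ c.eval x := by rw [hc]; exact Part.mem_some_iff.2 hx.symm
    obtain ⟨s, hs⟩ := Code.evaln_complete.1 this
    exact ⟨s, by unfold Visible; rw [Denumerable.ofNat_encode]; exact hs⟩
  set e := Encodable.encode c
  have hH : {x | h x = 1}.Infinite := Set.infinite_of_not_bddAbove fun ⟨b, hb⟩ => by
    obtain ⟨x, hlt, hx⟩ := hinf b
    exact absurd (hb hx) (not_le.2 hlt)
  obtain ⟨T, hT, hcard⟩ := hH.exists_subset_card_eq (2 * e + 2)
  choose! stage hstage using hcomplete
  -- The stage exceeds the index, the chosen elements and the times at which they become visible.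
  obtain ⟨s, hlt, hs⟩ := hinf (e + T.sup id + T.sup stage)
  refine ⟨s, hs, fun z hz => ?_⟩
  have hTV : ∀ x ∈ T, x ∈ visibleList s e := fun x hx => by
    have h1 : x ≤ T.sup id := Finset.le_sup (f := id) hx
    have h2 : stage x ≤ T.sup stage := Finset.le_sup hx
    exact mem_visibleList.2 ⟨by omega, Code.evaln_mono (by omega) (hstage x (hT hx))⟩
  have hlen : 2 * e + 2 ≤ (visibleList s e).length := by
    rw [← hcard]
    refine (Finset.card_le_card fun x hx => ?_).trans (List.toFinset_card_le _)
    exact List.mem_toFinset.2 (hTV x hx)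
  obtain ⟨x, hx, y, hy, h0, h1⟩ := (hz e (by omega)).resolve_left (not_lt.2 hlen)
  rw [mem_visibleList] at hx hy
  exact ⟨x, hx.1, y, hy.1, hsound hx.2, hsound hy.2, h0, h1⟩

/-- The first component of a pair. -/
def tupleFst (u : ℕ) : ℕ := u - u.sqrt * u.sqrt

/-- The second component of a pair. -/
def tupleSnd (u : ℕ) : ℕ := u.sqrt - tupleFst u

/-- Since `x ≤ 2 * (x + y)`, the code lies below the next square. -/
theorem sqrt_pair (x y : ℕ) : Nat.sqrt ((x + y) * (x + y) + x) = x + y :=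
  Nat.sqrt_add_eq _ (by omega)

theorem tupleFst_pair (x y : ℕ) : tupleFst ((x + y) * (x + y) + x) = x := by
  rw [tupleFst, sqrt_pair]
  omega

theorem tupleSnd_pair (x y : ℕ) : tupleSnd ((x + y) * (x + y) + x) = y := by
  rw [tupleSnd, tupleFst_pair, sqrt_pair]
  omega

theorem computable_tupleFst : Computable tupleFst :=
  (Primrec.nat_sub.comp Primrec.id (Primrec.nat_mul.comp Primrec.nat_sqrt Primrec.nat_sqrt)).to_comp

theorem computable_tupleSnd : Computable tupleSnd :=
  Primrec.nat_sub.to_comp.comp Primrec.nat_sqrt.to_comp computable_tupleFst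

theorem tupleFst_tupleCode {n : ℕ} (x : Fin (n + 1) → ℕ) : tupleFst (tupleCode (n + 1) x) = x 0 :=
  tupleFst_pair _ _

theorem tupleSnd_tupleCode {n : ℕ} (x : Fin (n + 1) → ℕ) :
    tupleSnd (tupleCode (n + 1) x) = tupleCode n (Fin.tail x) :=
  tupleSnd_pair _ _

/-- The colour of a tuple depends on its first two elements `x < s` only: it is the colour of `x` in
the splitting found at stage `s`. A computable unbounded set contains some `s` whose splitting gives
two of its smaller elements different colours. -/
theorem compStruc_not_RT {n k : ℕ} (hn : 2 ≤ n) (hk : 2 ≤ k) : ¬ compStruc.RT n k := by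
  obtain ⟨n, rfl⟩ := Nat.exists_eq_add_of_le' hn
  intro hRT
  classical
  obtain ⟨ζ, hζ, hsplit⟩ := exists_computable_choice (p := fun s z => decide (Splits s z))
    primrecRel_splits.decide.to_comp fun s => by simpa using exists_splits s
  simp only [decide_eq_true_eq] at hsplit
  -- `Splits` does not bound the colours in `ζ s`; truncation at `1` does, and preserves `0` and
  -- `1`.
  let d : ℕ → ℕ → ℕ := fun s x => min (colour (ζ s) x) 1
  let c : ℕ → ℕ := fun u => d (tupleFst (tupleSnd u)) (tupleFst u)
  have hc : Computable c :=
    Primrec.nat_min.to_comp.comp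
      (primrec_colour.to_comp.comp (hζ.comp (computable_tupleFst.comp computable_tupleSnd))
        computable_tupleFst) (Computable.const 1)
  have hcode : ∀ x : Fin (n + 2) → ℕ, c (tupleCode (n + 2) x) = d (x 1) (x 0) := fun x => by
    simp only [c, tupleFst_tupleCode, tupleSnd_tupleCode]
    rfl
  obtain ⟨(h : ℕ → ℕ), hh, hinf, hhom⟩ := hRT c hc ((Struc.omega_isColouring _ _ _ _).2 fun x _ => by
    rw [hcode]
    exact lt_of_le_of_lt (min_le_right _ _) (by omega))
  obtain ⟨-, hinf⟩ := (Struc.omega_isInfiniteSet _ h).1 hinf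
  obtain ⟨i, hi⟩ := (Struc.omega_isHomogeneous _ _ _ h).1 hhom
  obtain ⟨s, hs, hz⟩ := exists_stage_splitting h hh hinf
  obtain ⟨x, hxs, y, hys, hx, hy, h0, h1⟩ := hz _ (hsplit s)
  choose next hlt hnext using hinf
  -- An increasing sequence in the set starting at `s` completes any smaller element of the set to a
  -- tuple whose second entry is `s`.
  let t : ℕ → ℕ := fun j => next^[j] s
  have ht1 : ∀ j, h (t j) = 1 := fun j => by
    cases j with
    | zero => exact hs
    | succ j => simp only [t, Function.iterate_succ_apply', hnext]
  have htm : StrictMono t := strictMono_nat_of_lt_succ fun j => by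
    simp only [t, Function.iterate_succ_apply', hlt]
  have key : ∀ a < s, h a = 1 → d s a = i := fun a has ha => by
    have := hi (Fin.cons a fun j : Fin (n + 1) => t j) ?_ ?_
    · rwa [hcode] at this
    · refine Fin.strictMono_iff_lt_succ.2 fun j => ?_
      refine Fin.cases ?_ (fun j => ?_) j
      · exact has
      · exact htm (Nat.lt_succ_self _)
    · refine Fin.cases ha fun j => ht1 j
  have hx' := key x hxs hx
  have hy' := key y hys hy
  simp only [d, h0, h1] at hx' hy'
  omega

theorem not_delta01CA_implies_RT {n k : ℕ} (hn : 2 ≤ n) (hk : 2 ≤ k) :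
    ¬ ImpliesStandard (fun S => S.Delta01CA) fun S => S.RT n k := fun h =>
  compStruc_not_RT hn hk (h _ ⟨_, rfl⟩ compStruc_isModel compStruc_delta01CA)

theorem Implies.standard {A B : Struc → Prop} (h : Implies A B) : ImpliesStandard A B :=
  fun S _ => h S

end PRA2

theorem mainTheorem4 (n k : ℕ) (hn : 2 ≤ n) (hk : 2 ≤ k) :
    PRA2.Incomparable (fun S => S.RT n k) (fun S => S.Delta01CA) ∧
      PRA2.IncomparableStandard (fun S => S.RT n k) (fun S => S.Delta01CA) :=
  ⟨⟨fun h => PRA2.not_RT_implies_delta01CA n k h.standard,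
    fun h => PRA2.not_delta01CA_implies_RT hn hk h.standard⟩,
    PRA2.not_RT_implies_delta01CA n k, PRA2.not_delta01CA_implies_RT hn hk⟩
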